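/- Let $d\in\{2,3\}$, $\sigma>0$ and $c>0$. There is a constant $C>0$, depending only on $d$, $\sigma$ and $c$, such that the following holds. Let $\mathcal T$ be a conforming simplicial mesh (triangles for $d=2$, tetrahedra for $d=3$, finitely many closed elements) of a polygonal/polyhedral domain $\Omega\subset\mathbb R^d$, where $\Omega$ is the interior of the union of the elements. Let $h$ be the maximal diameter of an element, and suppose that $\mathcal T$ is shape regular with constant $\sigma$: each $T\in\mathcal T$ contains a ball of some radius $r>0$ with $\operatorname{diam}T\le 2\sigma r$. Let $\mathcal T=\mathcal T_1\cup\dots\cup\mathcal T_n$, where the $\mathcal T_i$ may overlap, and let $\omega_i=\bigcup_{T\in\mathcal T_i}T$. Suppose that the layer of elements of $\omega_i$ along its interface has thickness proportional to $h$: each $T\in\mathcal T_i$ that has a vertex on $\partial\omega_i\setminus\partial\Omega$ satisfies $\operatorname{diam}T\ge c\,h$. Let $$V_i=\{w\in H^1(\omega_i): w \text{ continuous on } \omega_i,\ w|_{\omega_i\cap\partial\Omega}=0,\ w|_T\in P_1(T)\ \ \forall T\in\mathcal T_i\},$$ $$V=\{v\in H^1(\Omega): v \text{ continuous on } \overline\Omega,\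 v|_{\partial\Omega}=0,\ v|_T\in P_1(T)\ \ \forall T\in\mathcal T\}.$$ Then for each $i$ there is exactly one linear operator $S_i:V_i\to V$ (the stitching operator) such that, for all $w\in V_i$ and every node $x$ of $\mathcal T$, $$(S_iw)(x)=\begin{cases} w(x), & x\in\omega_i\setminus\partial\omega_i,\\ 0, & \text{otherwise,}\end{cases}$$ and, with $\|w\|_{1,U}^2=\int_U w^2\,dx+\int_U|\nabla w|^2\,dx$, $$\|S_i\|:=\sup_{w\in V_i,\ w\neq0}\frac{\|S_iw\|_{1,\Omega}}{\|w\|_{1,\omega_i}}\le C\,(1+h^{-1}).$$ -/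

import Mathlib

open MeasureTheory Set
open scoped ContDiff

noncomputable section

namespace FEM

/-! ### Sobolev functions -/

section Sobolev

variable {E : Type*} [NormedAddCommGroup E] [InnerProductSpace ℝ E] [FiniteDimensional ℝ E]
  [MeasurableSpace E] [BorelSpace E]

/-- `g` is a weak gradient of `w` on the open set `U`: for each smooth `φ` with compact support
in `U` and each direction `e` one has `∫_U w ∂_e φ = -∫_U (g · e) φ`. -/
structure IsWeakGradient (U : Set E) (w : E → ℝ) (g : E → E) : Prop where
  locallyIntegrableOn_fun : LocallyIntegrableOn w U volume
  locallyIntegrableOn_grad : LocallyIntegrableOn g U volume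
  integral_eq : ∀ φ : E → ℝ, ContDiff ℝ ∞ φ → HasCompactSupport φ → tsupport φ ⊆ U → ∀ e : E,
    ∫ x in U, w x * fderiv ℝ φ x e = - ∫ x in U, inner ℝ (g x) e * φ x

/-- `w ∈ H¹(U)`. -/
def MemH1 (U : Set E) (w : E → ℝ) : Prop :=
  MemLp w 2 (volume.restrict U) ∧
    ∃ g : E → E, IsWeakGradient U w g ∧ MemLp g 2 (volume.restrict U)

/-- The norm `‖w‖_{1,U} = (‖w‖²_{0,U} + ‖∇w‖²_{0,U})^{1/2}`, where `∇w` is the weak gradient on `U`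
(unique up to null sets, so that the infimum is over a single value; it is `∞` if there is no weak
gradient). -/
def h1Norm (U : Set E) (w : E → ℝ) : ENNReal :=
  ⨅ (g : E → E) (_ : IsWeakGradient U w g),
    ((∫⁻ x in U, ‖w x‖ₑ ^ 2) + ∫⁻ x in U, ‖g x‖ₑ ^ 2) ^ (1 / 2 : ℝ)

theorem integrable_mul_of_tsupport {F : Type*} [NormedAddCommGroup F] [NormedSpace ℝ F]
    {U : Set E} {f : E → F} (hf : LocallyIntegrableOn f U volume) {ψ : E → ℝ}
    (hψ : Continuous ψ) (hc : HasCompactSupport ψ) (hs : tsupport ψ ⊆ U) :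
    Integrable (fun x => ψ x • f x) (volume.restrict U) := by
  have h1 : IntegrableOn f (tsupport ψ) volume := hf.integrableOn_compact_subset hs hc
  have h2 : IntegrableOn (fun x => ψ x • f x) (tsupport ψ) volume :=
    h1.continuousOn_smul hψ.continuousOn hc
  have h3 : Integrable (fun x => ψ x • f x) volume := by
    refine (integrableOn_iff_integrable_of_support_subset ?_).1 h2
    intro x hx
    refine subset_tsupport ψ ?_
    intro h0
    exact hx (by simp [h0])
  exact h3.restrict

theorem IsWeakGradient.zero (U : Set E) : IsWeakGradient U (0 : E → ℝ) (0 : E → E) where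
  locallyIntegrableOn_fun := locallyIntegrableOn_zero
  locallyIntegrableOn_grad := locallyIntegrableOn_zero
  integral_eq := by simp

theorem IsWeakGradient.add {U : Set E} {w₁ w₂ : E → ℝ} {g₁ g₂ : E → E}
    (h₁ : IsWeakGradient U w₁ g₁) (h₂ : IsWeakGradient U w₂ g₂) :
    IsWeakGradient U (w₁ + w₂) (g₁ + g₂) where
  locallyIntegrableOn_fun := h₁.locallyIntegrableOn_fun.add h₂.locallyIntegrableOn_fun
  locallyIntegrableOn_grad := h₁.locallyIntegrableOn_grad.add h₂.locallyIntegrableOn_grad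
  integral_eq φ hφ hc hs e := by
    have hd : Continuous fun x => fderiv ℝ φ x e :=
      (hφ.continuous_fderiv (by simp)).clm_apply continuous_const
    have hdc : HasCompactSupport fun x => fderiv ℝ φ x e := hc.fderiv_apply (𝕜 := ℝ) e
    have hds : tsupport (fun x => fderiv ℝ φ x e) ⊆ U :=
      (tsupport_fderiv_apply_subset ℝ e).trans hs
    have i₁ := integrable_mul_of_tsupport h₁.locallyIntegrableOn_fun hd hdc hds
    have i₂ := integrable_mul_of_tsupport h₂.locallyIntegrableOn_fun hd hdc hds
    have j₁ := (integrable_mul_of_tsupport h₁.locallyIntegrableOn_grad hφ.continuous hc hs).inner_const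
      (𝕜 := ℝ) e
    have j₂ := (integrable_mul_of_tsupport h₂.locallyIntegrableOn_grad hφ.continuous hc hs).inner_const
      (𝕜 := ℝ) e
    have k₁ := h₁.integral_eq φ hφ hc hs e
    have k₂ := h₂.integral_eq φ hφ hc hs e
    simp only [smul_eq_mul, real_inner_smul_left, mul_comm (fderiv ℝ φ _ e),
      mul_comm (φ _)] at i₁ i₂ j₁ j₂
    simp only [Pi.add_apply, add_mul, inner_add_left]
    rw [integral_add i₁ i₂, integral_add j₁ j₂, k₁, k₂]
    ring

theorem IsWeakGradient.smul {U : Set E} {w : E → ℝ} {g : E → E} (h : IsWeakGradient U w g)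
    (c : ℝ) : IsWeakGradient U (c • w) (c • g) where
  locallyIntegrableOn_fun := h.locallyIntegrableOn_fun.smul c
  locallyIntegrableOn_grad := h.locallyIntegrableOn_grad.smul c
  integral_eq φ hφ hc hs e := by
    have k := h.integral_eq φ hφ hc hs e
    simp only [Pi.smul_apply, smul_eq_mul, real_inner_smul_left, mul_assoc]
    rw [integral_const_mul, integral_const_mul, k]
    ring

theorem MemH1.zero (U : Set E) : MemH1 U (0 : E → ℝ) :=
  ⟨MemLp.zero, 0, IsWeakGradient.zero U, MemLp.zero⟩

theorem MemH1.add {U : Set E} {w₁ w₂ : E → ℝ} (h₁ : MemH1 U w₁) (h₂ : MemH1 U w₂) :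
    MemH1 U (w₁ + w₂) := by
  obtain ⟨a₁, g₁, b₁, c₁⟩ := h₁
  obtain ⟨a₂, g₂, b₂, c₂⟩ := h₂
  exact ⟨a₁.add a₂, g₁ + g₂, b₁.add b₂, c₁.add c₂⟩

theorem MemH1.smul {U : Set E} {w : E → ℝ} (h : MemH1 U w) (c : ℝ) : MemH1 U (c • w) := by
  obtain ⟨a, g, b, c'⟩ := h
  exact ⟨a.const_smul c, c • g, b.smul c, c'.const_smul c⟩

end Sobolev

/-! ### Meshes -/

/-- A conforming simplicial mesh in `ℝᵈ`: a finite geometric simplicial complex all of whose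
simplices are faces of `d`-dimensional simplices. -/
structure Mesh (d : ℕ) extends
    Geometry.SimplicialComplex ℝ (EuclideanSpace ℝ (Fin d)) where
  finite_faces : faces.Finite
  exists_cell : ∀ s ∈ faces, ∃ t ∈ faces, s ⊆ t ∧ t.card = d + 1

namespace Mesh

variable {d : ℕ} (M : Mesh d)

/-- The elements of the mesh (triangles for `d = 2`, tetrahedra for `d = 3`), each given by the set
of its vertices; the closed simplex is the convex hull of that set. -/
def cells : Set (Finset (EuclideanSpace ℝ (Fin d))) :=
  {T | T ∈ M.faces ∧ T.card = d + 1}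

/-- The closed polyhedral set covered by a set of elements. -/
def region (𝒮 : Set (Finset (EuclideanSpace ℝ (Fin d)))) : Set (EuclideanSpace ℝ (Fin d)) :=
  ⋃ T ∈ 𝒮, convexHull ℝ (T : Set (EuclideanSpace ℝ (Fin d)))

/-- The open polyhedral domain `Ω` that is triangulated by the mesh. -/
def domain : Set (EuclideanSpace ℝ (Fin d)) :=
  interior (region M.cells)

/-- The mesh size `h`: the maximal diameter of an element. -/
def meshSize : ℝ :=
  sSup ((fun T : Finset (EuclideanSpace ℝ (Fin d)) =>
    Metric.diam (convexHull ℝ (T : Set (EuclideanSpace ℝ (Fin d))))) '' M.cells)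

/-- Shape regularity with constant `σ`: each element contains a ball whose diameter `2 r` satisfies
`diam T ≤ σ (2 r)`. -/
def IsShapeRegular (σ : ℝ) : Prop :=
  ∀ T ∈ M.cells, ∃ (x : EuclideanSpace ℝ (Fin d)) (r : ℝ), 0 < r ∧
    Metric.closedBall x r ⊆ convexHull ℝ (T : Set (EuclideanSpace ℝ (Fin d))) ∧
    Metric.diam (convexHull ℝ (T : Set (EuclideanSpace ℝ (Fin d)))) ≤ σ * (2 * r)

/-- The continuous piecewise linear functions in `H¹` of the subdomain covered by the elements in
`𝒮` that vanish on the part of `∂Ω` in that (closed) subdomain. A function on the closed subdomain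
is represented by its extension by the value zero. -/
def p1Space (𝒮 : Set (Finset (EuclideanSpace ℝ (Fin d)))) :
    Submodule ℝ (EuclideanSpace ℝ (Fin d) → ℝ) where
  carrier := {w | MemH1 (interior (region 𝒮)) w ∧ ContinuousOn w (region 𝒮) ∧
    (∀ x ∈ region 𝒮 ∩ frontier M.domain, w x = 0) ∧
    (∀ T ∈ 𝒮, ∃ a : EuclideanSpace ℝ (Fin d) →ᵃ[ℝ] ℝ,
      EqOn w a (convexHull ℝ (T : Set (EuclideanSpace ℝ (Fin d))))) ∧
    ∀ x ∉ region 𝒮, w x = 0}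
  zero_mem' :=
    ⟨MemH1.zero _, continuousOn_const, fun _ _ => rfl, fun _ _ => ⟨0, fun _ _ => rfl⟩,
      fun _ _ => rfl⟩
  add_mem' := by
    rintro u v ⟨u1, u2, u3, u4, u5⟩ ⟨v1, v2, v3, v4, v5⟩
    refine ⟨u1.add v1, u2.add v2, fun x hx => ?_, fun T hT => ?_, fun x hx => ?_⟩
    · simp [u3 x hx, v3 x hx]
    · obtain ⟨a, ha⟩ := u4 T hT
      obtain ⟨b, hb⟩ := v4 T hT
      exact ⟨a + b, fun x hx => by simp [ha hx, hb hx]⟩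
    · simp [u5 x hx, v5 x hx]
  smul_mem' := by
    rintro c u ⟨u1, u2, u3, u4, u5⟩
    refine ⟨u1.smul c, u2.const_smul c, fun x hx => ?_, fun T hT => ?_, fun x hx => ?_⟩
    · simp [u3 x hx]
    · obtain ⟨a, ha⟩ := u4 T hT
      exact ⟨c • a, fun x hx => by simp [ha hx]⟩
    · simp [u5 x hx]

/-- The global finite element space `V ⊂ H¹₀(Ω)`. -/
abbrev V : Submodule ℝ (EuclideanSpace ℝ (Fin d) → ℝ) := M.p1Space M.cells

end Mesh

/-! ### Domain decomposition and stitching -/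

/-- A decomposition of the domain of a mesh into `n` subdomains, each a union of elements. The
elements of a subdomain `ωᵢ` with a vertex on the interface `∂ωᵢ \ ∂Ω` (the layer of elements
through which `ωᵢ` overlaps the other subdomains) have size proportional to the mesh size `h`:
their diameter, which is at most `h`, is at least `c h`. -/
structure Decomposition {d : ℕ} (M : Mesh d) (n : ℕ) (c : ℝ) where
  /-- The elements of the local mesh `𝒯ᵢ`. -/
  cells : Fin n → Set (Finset (EuclideanSpace ℝ (Fin d)))
  iUnion_cells : ⋃ i, cells i = M.cells
  le_diam : ∀ i, ∀ T ∈ cells i,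
    (∃ x ∈ T, x ∈ frontier (Mesh.region (cells i)) \ frontier M.domain) →
    c * M.meshSize ≤ Metric.diam (convexHull ℝ (T : Set (EuclideanSpace ℝ (Fin d))))

namespace Decomposition

variable {d : ℕ} {M : Mesh d} {n : ℕ} {c : ℝ} (D : Decomposition M n c)

/-- The closed subdomain `ωᵢ`. -/
def subdomain (i : Fin n) : Set (EuclideanSpace ℝ (Fin d)) := Mesh.region (D.cells i)

/-- The local finite element space `Vᵢ`. -/
abbrev V (i : Fin n) : Submodule ℝ (EuclideanSpace ℝ (Fin d) → ℝ) := M.p1Space (D.cells i)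

open Classical in
/-- `S : Vᵢ → V` is the stitching operator: at each node `x` of the mesh, `S w` has the value `w x`
if `x` lies in `ωᵢ \ ∂ωᵢ`, and the value `0` otherwise. -/
def IsStitching (i : Fin n) (S : D.V i →ₗ[ℝ] M.V) : Prop :=
  ∀ w : D.V i, ∀ x ∈ M.vertices,
    (S w : EuclideanSpace ℝ (Fin d) → ℝ) x =
      if x ∈ D.subdomain i \ frontier (D.subdomain i) then
        (w : EuclideanSpace ℝ (Fin d) → ℝ) x else 0

/-- The operator norm `sup_{w ∈ Vᵢ} ‖S w‖_{1,Ω} / ‖w‖_{1,ωᵢ}`. In `[0,∞]` one has `0 / 0 = 0` and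
`a / 0 = ∞` for `a ≠ 0`, so that `w = 0` contributes nothing to the supremum. -/
def opNorm (i : Fin n) (S : D.V i →ₗ[ℝ] M.V) : ENNReal :=
  ⨆ w : D.V i, h1Norm M.domain (S w : EuclideanSpace ℝ (Fin d) → ℝ) /
    h1Norm (interior (D.subdomain i)) (w : EuclideanSpace ℝ (Fin d) → ℝ)

end Decomposition

end FEM

end

open MeasureTheory Set Filter Topology
open scoped ContDiff NNReal ENNReal

noncomputable section

namespace FEM

/-! ### Affine functions on convex hulls. -/

section Affine

variable {E : Type*} [NormedAddCommGroup E] [InnerProductSpace ℝ E]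

/-! The bound is local: on each element `T` the stitched function `Sw` is compared with `w` on that
same element.

If `T` is not in `𝒯ᵢ`, none of its vertices is interior to `ωᵢ` (`mem_of_vertex_mem_interior`), so
`Sw = 0` on `T`. If `T ∈ 𝒯ᵢ` has no vertex on the interface, each vertex where `Sw` is set to zero
lies on `∂Ω`, where `w` vanishes anyway, so `Sw = w` on `T`. Otherwise `diam T ≥ c h`, and shape
regularity gives an inscribed ball of radius `r ≥ c h / (2σ)`. The nodal values of `Sw` are those of
`w` or zero, so `|Sw| ≤ max |w|` on `T`, and the inverse estimate `lintegral_affine_le` bounds the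
`H¹` norm of `Sw` by a constant times `1 + r⁻¹` times the `L²` norm of `w`. Summing the squares over
elements gives `C (1 + h⁻¹)`.

To pass between broken and weak gradients, `Sw` extended by zero is globally Lipschitz, so its
classical gradient is a weak one (`isWeakGradient_of_lipschitzWith`); on `w`, every weak gradient is
at least as long as the elementwise one (`IsWeakGradient.enorm_affineGrad_le`).

Existence of `S` is nodal interpolation. The delicate point is that the interpolant vanishes on all
of `∂Ω`, for which no regularity of `∂Ω` is available; this is `mem_domain_of_coord_pos`. Uniqueness
holds because nodal values determine a function in `V`. -/

theorem eqOn_convexHull_of_eqOn {s : Set E} {a b : E →ᵃ[ℝ] ℝ} (h : EqOn a b s) :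
    EqOn a b (convexHull ℝ s) := fun _ hx =>
  AffineMap.eqOn_affineSpan h (convexHull_subset_affineSpan s hx)

theorem abs_le_on_convexHull {s : Set E} (a : E →ᵃ[ℝ] ℝ) {K : ℝ} (h : ∀ v ∈ s, |a v| ≤ K) {x : E}
    (hx : x ∈ convexHull ℝ s) : |a x| ≤ K := by
  have hs : s ⊆ a ⁻¹' Icc (-K) K := fun v hv => abs_le.1 (h v hv)
  exact abs_le.2 (convexHull_min hs ((convex_Icc (-K) K).affine_preimage a) hx)

end Affine

/-! ### Barycentric coordinates and the geometry of a conforming mesh. -/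

namespace Mesh

variable {d : ℕ} (M : Mesh d)

theorem finite_cells : M.cells.Finite := M.finite_faces.subset fun _ h => h.1

theorem mem_region {𝒮 : Set (Finset (EuclideanSpace ℝ (Fin d)))} {x : EuclideanSpace ℝ (Fin d)} :
    x ∈ region 𝒮 ↔ ∃ T ∈ 𝒮, x ∈ convexHull ℝ (T : Set (EuclideanSpace ℝ (Fin d))) := by
  simp [region]

theorem convexHull_subset_region {𝒮 : Set (Finset (EuclideanSpace ℝ (Fin d)))}
    {T : Finset (EuclideanSpace ℝ (Fin d))} (hT : T ∈ 𝒮) :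
    convexHull ℝ (T : Set (EuclideanSpace ℝ (Fin d))) ⊆ region 𝒮 :=
  fun _ hx => mem_region.2 ⟨T, hT, hx⟩

theorem isCompact_cell (T : Finset (EuclideanSpace ℝ (Fin d))) :
    IsCompact (convexHull ℝ (T : Set (EuclideanSpace ℝ (Fin d)))) :=
  T.finite_toSet.isCompact_convexHull ℝ

theorem isCompact_region {𝒮 : Set (Finset (EuclideanSpace ℝ (Fin d)))} (h𝒮 : 𝒮 ⊆ M.cells) :
    IsCompact (region 𝒮) :=
  (M.finite_cells.subset h𝒮).isCompact_biUnion fun T _ => isCompact_cell T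

theorem mem_vertices_of_mem {T : Finset (EuclideanSpace ℝ (Fin d))} (hT : T ∈ M.cells)
    {v : EuclideanSpace ℝ (Fin d)} (hv : v ∈ T) : v ∈ M.vertices :=
  M.down_closed hT.1 (Finset.singleton_subset_iff.2 hv) (Finset.singleton_nonempty v)

variable {M} {T T' : Finset (EuclideanSpace ℝ (Fin d))}

/-- The affine basis formed by the vertices of an element. -/
def basis (hT : T ∈ M.cells) : AffineBasis T ℝ (EuclideanSpace ℝ (Fin d)) where
  toFun := (↑)
  ind' := M.indep hT.1
  tot' := by
    refine (M.indep hT.1).affineSpan_eq_top_iff_card_eq_finrank_add_one.2 ?_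
    simp [hT.2]

theorem basis_apply (hT : T ∈ M.cells) (v : T) : basis hT v = v := rfl

theorem convexHull_eq (hT : T ∈ M.cells) :
    convexHull ℝ (T : Set (EuclideanSpace ℝ (Fin d))) = {x | ∀ v, 0 ≤ (basis hT).coord v x} := by
  rw [← (basis hT).convexHull_eq_nonneg_coord]
  congr 1
  ext x
  simp [basis_apply]

theorem nonempty_interior (hT : T ∈ M.cells) :
    (interior (convexHull ℝ (T : Set (EuclideanSpace ℝ (Fin d))))).Nonempty := by
  rw [interior_convexHull_nonempty_iff_affineSpan_eq_top]
  have := (basis hT).tot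
  rwa [show range (basis hT) = T by ext x; simp [basis_apply]] at this

theorem closure_interior_cell (hT : T ∈ M.cells) :
    closure (interior (convexHull ℝ (T : Set (EuclideanSpace ℝ (Fin d))))) =
      convexHull ℝ (T : Set (EuclideanSpace ℝ (Fin d))) := by
  rw [(convex_convexHull ℝ _).closure_interior_eq_closure_of_nonempty_interior
    (nonempty_interior hT), (isCompact_cell T).isClosed.closure_eq]

/-- The affine function with given values at the vertices of an element. -/
def interp (hT : T ∈ M.cells) (z : EuclideanSpace ℝ (Fin d) → ℝ) :
    EuclideanSpace ℝ (Fin d) →ᵃ[ℝ] ℝ :=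
  ∑ v : T, z v • (basis hT).coord v

theorem interp_eq_sum (hT : T ∈ M.cells) (z : EuclideanSpace ℝ (Fin d) → ℝ)
    (x : EuclideanSpace ℝ (Fin d)) :
    interp hT z x = ∑ v : T, z v * (basis hT).coord v x := by
  have h : ∀ s : Finset T, (∑ v ∈ s, z v • (basis hT).coord v) x =
      ∑ v ∈ s, z v * (basis hT).coord v x := by
    classical
    intro s
    induction s using Finset.induction_on with
    | empty => simp
    | insert v s hv ih => simp [Finset.sum_insert hv, ih]
  exact h _

theorem interp_apply (hT : T ∈ M.cells) (z : EuclideanSpace ℝ (Fin d) → ℝ)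
    {v : EuclideanSpace ℝ (Fin d)} (hv : v ∈ T) : interp hT z v = z v := by
  classical
  rw [interp_eq_sum, Finset.sum_eq_single (⟨v, hv⟩ : T)]
  · have := (basis hT).coord_apply_eq (⟨v, hv⟩ : T)
    rw [basis_apply] at this
    simp [this]
  · intro u _ hu
    have := (basis hT).coord_apply_ne hu
    rw [basis_apply] at this
    simp [this]
  · simp

/-- By conformity a common point lies in the hull of the common vertices, where both interpolants
take the same values. This makes `nodalInterp` independent of the chosen element. -/
theorem interp_eq_interp (hT : T ∈ M.cells) (hT' : T' ∈ M.cells)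
    (z : EuclideanSpace ℝ (Fin d) → ℝ) {x : EuclideanSpace ℝ (Fin d)}
    (hx : x ∈ convexHull ℝ (T : Set (EuclideanSpace ℝ (Fin d))))
    (hx' : x ∈ convexHull ℝ (T' : Set (EuclideanSpace ℝ (Fin d)))) :
    interp hT z x = interp hT' z x := by
  refine eqOn_convexHull_of_eqOn ?_ (M.inter_subset_convexHull hT.1 hT'.1 ⟨hx, hx'⟩)
  intro v hv
  rw [interp_apply hT z hv.1, interp_apply hT' z hv.2]

/-- Two distinct elements meet in a null set. -/
theorem volume_inter_eq_zero (hT : T ∈ M.cells) (hT' : T' ∈ M.cells) (hne : T ≠ T') :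
    volume (convexHull ℝ (T : Set (EuclideanSpace ℝ (Fin d))) ∩
      convexHull ℝ (T' : Set (EuclideanSpace ℝ (Fin d)))) = 0 := by
  refine measure_mono_null ((M.inter_subset_convexHull hT.1 hT'.1).trans
    (convexHull_subset_affineSpan _)) (Measure.addHaar_affineSubspace _ _ fun htop => ?_)
  obtain ⟨v, hv, hv'⟩ : ∃ v ∈ T, v ∉ T' := by
    by_contra! h
    exact hne (Finset.eq_of_subset_of_card_le h (by rw [hT.2, hT'.2]))
  -- The barycentric coordinate of a vertex `v` missing from `T'` vanishes on the common vertices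
  -- but not at `v`, so their affine span is proper, hence null.
  have h0 : EqOn ((basis hT).coord ⟨v, hv⟩) (0 : EuclideanSpace ℝ (Fin d) →ᵃ[ℝ] ℝ)
      ((T : Set (EuclideanSpace ℝ (Fin d))) ∩ T') := by
    rintro u ⟨hu, hu'⟩
    have : (⟨v, hv⟩ : T) ≠ ⟨u, hu⟩ := by
      rintro h
      rw [Subtype.mk.injEq] at h
      exact hv' (h ▸ hu')
    simpa [basis_apply] using (basis hT).coord_apply_ne this
  have h1 := AffineMap.eqOn_affineSpan h0 (x := v) (by rw [htop]; trivial)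
  have h2 := (basis hT).coord_apply_eq ⟨v, hv⟩
  rw [basis_apply] at h2
  rw [h2] at h1
  simp at h1

theorem volume_frontier_cell (T : Finset (EuclideanSpace ℝ (Fin d))) :
    volume (frontier (convexHull ℝ (T : Set (EuclideanSpace ℝ (Fin d))))) = 0 :=
  (convex_convexHull ℝ _).addHaar_frontier volume

theorem disjoint_interior (hT : T ∈ M.cells) (hT' : T' ∈ M.cells) (hne : T ≠ T') :
    Disjoint (interior (convexHull ℝ (T : Set (EuclideanSpace ℝ (Fin d)))))
      (interior (convexHull ℝ (T' : Set (EuclideanSpace ℝ (Fin d))))) := by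
  rw [disjoint_iff_inter_eq_empty]
  refine (isOpen_interior.inter isOpen_interior).eq_empty_of_measure_zero (μ := volume) ?_
  exact measure_mono_null (inter_subset_inter interior_subset interior_subset)
    (volume_inter_eq_zero hT hT' hne)

/-- An element with a vertex in the interior of a union of elements is one of them. -/
theorem mem_of_vertex_mem_interior {𝒮 : Set (Finset (EuclideanSpace ℝ (Fin d)))}
    (h𝒮 : 𝒮 ⊆ M.cells) (hT : T ∈ M.cells) {v : EuclideanSpace ℝ (Fin d)} (hv : v ∈ T)
    (hi : v ∈ interior (region 𝒮)) : T ∈ 𝒮 := by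
  by_contra hTS
  have hvT : v ∈ closure (interior (convexHull ℝ (T : Set (EuclideanSpace ℝ (Fin d))))) := by
    rw [closure_interior_cell hT]
    exact subset_convexHull ℝ _ hv
  -- Near `v`, a nonempty open piece of `T` is covered by the elements of `𝒮`, although `T` meets
  -- each of them in a null set.
  have hne := mem_closure_iff.1 hvT _ isOpen_interior hi
  refine ((isOpen_interior.inter isOpen_interior).measure_pos volume hne).ne' ?_
  refine measure_mono_null (t := ⋃ T' ∈ 𝒮, convexHull ℝ (T : Set (EuclideanSpace ℝ (Fin d))) ∩
      convexHull ℝ (T' : Set (EuclideanSpace ℝ (Fin d)))) ?_ ?_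
  · rintro x ⟨hx, hxT⟩
    obtain ⟨T', hT', hx'⟩ := mem_region.1 (interior_subset hx)
    exact mem_biUnion hT' ⟨interior_subset hxT, hx'⟩
  · rw [measure_biUnion_null_iff (M.finite_cells.subset h𝒮).countable]
    exact fun T' hT' => volume_inter_eq_zero hT (h𝒮 hT') fun h => hTS (h ▸ hT')

variable (M)

theorem region_cells_subset_closure : region M.cells ⊆ closure M.domain := by
  intro x hx
  obtain ⟨T, hT, hx⟩ := mem_region.1 hx
  rw [← closure_interior_cell hT] at hx
  exact closure_mono (interior_mono (convexHull_subset_region hT)) hx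

/-- Each element is the closure of its interior, so the closure of the domain is the whole closed
region. -/
theorem mem_frontier_domain_iff {x : EuclideanSpace ℝ (Fin d)} :
    x ∈ frontier M.domain ↔ x ∈ region M.cells ∧ x ∉ M.domain := by
  have hc : IsClosed (region M.cells) := (M.isCompact_region Subset.rfl).isClosed
  rw [frontier, domain, interior_interior]
  refine ⟨fun h => ⟨closure_minimal interior_subset hc h.1, h.2⟩, fun h => ⟨?_, h.2⟩⟩
  exact M.region_cells_subset_closure h.1

variable {M}

/-- If a vertex `v` lies inside the domain, so do all points of the closed elements at `v` where
the barycentric coordinate of `v` is positive. -/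
theorem mem_domain_of_coord_pos (hT : T ∈ M.cells) {v : EuclideanSpace ℝ (Fin d)} (hv : v ∈ T)
    (hvd : v ∈ M.domain) {x : EuclideanSpace ℝ (Fin d)}
    (hx : x ∈ convexHull ℝ (T : Set (EuclideanSpace ℝ (Fin d))))
    (hpos : 0 < (basis hT).coord ⟨v, hv⟩ x) : x ∈ M.domain := by
  have hline : ∀ {T' : Finset (EuclideanSpace ℝ (Fin d))} (hT' : T' ∈ M.cells) (u : T') (t : ℝ)
      (y : EuclideanSpace ℝ (Fin d)), (basis hT').coord u (AffineMap.lineMap v y t) =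
        (1 - t) * (basis hT').coord u v + t * (basis hT').coord u y := by
    intro T' hT' u t y
    rw [AffineMap.apply_lineMap, AffineMap.lineMap_apply_module]
    simp
  have hself : ∀ {T' : Finset (EuclideanSpace ℝ (Fin d))} (hT' : T' ∈ M.cells) (hv' : v ∈ T'),
      (basis hT').coord ⟨v, hv'⟩ v = 1 := fun hT' hv' => (basis hT').coord_apply_eq ⟨v, hv'⟩
  have hother : ∀ {T' : Finset (EuclideanSpace ℝ (Fin d))} (hT' : T' ∈ M.cells) (hv' : v ∈ T')
      (u : T'), (u : EuclideanSpace ℝ (Fin d)) ≠ v → (basis hT').coord u v = 0 :=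
    fun hT' hv' u hu => (basis hT').coord_apply_ne (j := ⟨v, hv'⟩) fun h => hu (by rw [h])
  -- the points of the cone at `v` over the opposite facet, beyond that facet
  let B : Finset (EuclideanSpace ℝ (Fin d)) → Set (EuclideanSpace ℝ (Fin d)) := fun T' =>
    {y | ∃ (hT' : T' ∈ M.cells) (hv' : v ∈ T'), (∀ u : T', (u : EuclideanSpace ℝ (Fin d)) ≠ v →
      0 ≤ (basis hT').coord u y) ∧ (basis hT').coord ⟨v, hv'⟩ y ≤ 0}
  have hBclosed : ∀ T', IsClosed (B T') := by
    intro T'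
    by_cases h : T' ∈ M.cells ∧ v ∈ T'
    · obtain ⟨hT', hv'⟩ := h
      have : B T' = (⋂ u : T', ⋂ _ : (u : EuclideanSpace ℝ (Fin d)) ≠ v,
          {y | 0 ≤ (basis hT').coord u y}) ∩ {y | (basis hT').coord ⟨v, hv'⟩ y ≤ 0} := by
        ext y
        simp [B, hT', hv']
      rw [this]
      refine IsClosed.inter (isClosed_iInter fun u => isClosed_iInter fun _ => ?_) ?_
      · exact isClosed_le continuous_const (continuous_barycentric_coord _ u)
      · exact isClosed_le (continuous_barycentric_coord _ _) continuous_const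
    · have : B T' = ∅ := by
        ext y
        simp only [B, mem_ofPred_eq, mem_empty_iff_false, iff_false]
        rintro ⟨hT', hv', -⟩
        exact h ⟨hT', hv'⟩
      rw [this]
      exact isClosed_empty
  have hcl : IsClosed (⋃ T' ∈ M.cells, B T') :=
    M.finite_cells.isClosed_biUnion fun T' _ => hBclosed T'
  -- Moving from `v` a little towards `y` stays in the domain and away from the elements not
  -- containing `v`, hence lands in some `T'` at `v`. The coordinates of the other vertices only
  -- scale along this ray, so they are nonnegative at `y`; the coordinate of `v` must then be
  -- nonpositive, as `y ∉ T'`.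
  have hsub : (region M.cells)ᶜ ⊆ ⋃ T' ∈ M.cells, B T' := by
    intro y hy
    have hN : M.domain ∩ ⋂ T' ∈ {T' ∈ M.cells | v ∉ T'},
        (convexHull ℝ (T' : Set (EuclideanSpace ℝ (Fin d))))ᶜ ∈ 𝓝 v := by
      refine inter_mem (isOpen_interior.mem_nhds hvd) ?_
      refine (biInter_mem (M.finite_cells.subset fun _ h => h.1)).2 fun T' hT' => ?_
      refine (isCompact_cell T').isClosed.isOpen_compl.mem_nhds fun hvT' => ?_
      have h1 : v ∈ convexHull ℝ (({v} : Finset (EuclideanSpace ℝ (Fin d))) :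
          Set (EuclideanSpace ℝ (Fin d))) := by simp
      have h2 := M.inter_subset_convexHull (M.mem_vertices_of_mem hT hv) hT'.1.1 ⟨h1, hvT'⟩
      have h3 : (({v} : Finset (EuclideanSpace ℝ (Fin d))) : Set (EuclideanSpace ℝ (Fin d))) ∩ T'
          = ∅ := by
        ext u
        simp only [Finset.coe_singleton, mem_inter_iff, mem_singleton_iff, Finset.mem_coe,
          mem_empty_iff_false, iff_false, not_and]
        rintro rfl
        exact hT'.2
      rw [h3, convexHull_empty] at h2
      exact h2
    have hc : Tendsto (fun t : ℝ => AffineMap.lineMap v y t) (𝓝[>] 0) (𝓝 v) := by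
      have : Continuous fun t : ℝ => (AffineMap.lineMap v y t : EuclideanSpace ℝ (Fin d)) :=
        AffineMap.lineMap_continuous
      simpa using (this.tendsto 0).mono_left nhdsWithin_le_nhds
    obtain ⟨t, ht, ht0⟩ := ((hc.eventually hN).and self_mem_nhdsWithin).exists
    have ht0 : 0 < t := ht0
    obtain ⟨T', hT', hzT'⟩ := mem_region.1 (interior_subset ht.1)
    have hvT' : v ∈ T' := by
      by_contra h
      exact mem_iInter₂.1 ht.2 T' ⟨hT', h⟩ hzT'
    rw [convexHull_eq hT'] at hzT'
    have hnn : ∀ u : T', (u : EuclideanSpace ℝ (Fin d)) ≠ v → 0 ≤ (basis hT').coord u y := by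
      intro u hu
      have := hzT' u
      rw [hline, hother hT' hvT' u hu, mul_zero, zero_add] at this
      exact nonneg_of_mul_nonneg_right this ht0
    refine mem_biUnion hT' ⟨hT', hvT', hnn, ?_⟩
    by_contra! hlt
    refine hy (mem_region.2 ⟨T', hT', ?_⟩)
    rw [convexHull_eq hT']
    intro u
    by_cases hu : (u : EuclideanSpace ℝ (Fin d)) = v
    · have : u = ⟨v, hvT'⟩ := Subtype.ext hu
      rw [this]
      exact hlt.le
    · exact hnn u hu
  by_contra hxd
  rw [domain, ← mem_compl_iff, ← closure_compl] at hxd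
  obtain ⟨T', -, hT', hvT', hnn, hle⟩ := mem_iUnion₂.1 (closure_minimal hsub hcl hxd)
  -- The chosen `t` is where the segment from `v` to `x` crosses the facet of `T'` opposite `v`.
  -- That point lies in both `T` and `T'`, where the coordinates of `v` agree; hence they agree at
  -- `x`, one being positive and the other not.
  obtain ⟨t, ⟨ht0, ht1⟩, ht⟩ : ∃ t : ℝ, (0 < t ∧ t ≤ 1) ∧
      0 ≤ (1 - t) + t * (basis hT').coord ⟨v, hvT'⟩ x := by
    set q := (basis hT').coord ⟨v, hvT'⟩ x
    have : 0 < 1 - q := by linarith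
    refine ⟨1 / (1 - q), ⟨by positivity, ?_⟩, ?_⟩
    · rw [div_le_one this]; linarith
    · have : 1 / (1 - q) * (1 - q) = 1 := by field_simp
      nlinarith
  have hzT : AffineMap.lineMap v x t ∈ convexHull ℝ (T : Set (EuclideanSpace ℝ (Fin d))) :=
    (convex_convexHull ℝ _).lineMap_mem (subset_convexHull ℝ _ hv) hx ⟨ht0.le, ht1⟩
  have hzT' : AffineMap.lineMap v x t ∈ convexHull ℝ (T' : Set (EuclideanSpace ℝ (Fin d))) := by
    rw [convexHull_eq hT']
    intro u
    rw [hline]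
    by_cases hu : (u : EuclideanSpace ℝ (Fin d)) = v
    · have : u = ⟨v, hvT'⟩ := Subtype.ext hu
      rw [this, hself hT' hvT', mul_one]
      exact ht
    · rw [hother hT' hvT' u hu, mul_zero, zero_add]
      exact mul_nonneg ht0.le (hnn u hu)
  have heq : EqOn ((basis hT).coord ⟨v, hv⟩) ((basis hT').coord ⟨v, hvT'⟩)
      ((T : Set (EuclideanSpace ℝ (Fin d))) ∩ T') := by
    rintro u ⟨hu, hu'⟩
    by_cases huv : u = v
    · subst huv
      rw [hself hT hv, hself hT' hvT']
    · have h1 := (basis hT).coord_apply_ne (i := ⟨v, hv⟩) (j := ⟨u, hu⟩)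
        fun h => huv (by simpa using h.symm)
      have h2 := (basis hT').coord_apply_ne (i := ⟨v, hvT'⟩) (j := ⟨u, hu'⟩)
        fun h => huv (by simpa using h.symm)
      rw [basis_apply] at h1 h2
      rw [h1, h2]
  have := eqOn_convexHull_of_eqOn heq (M.inter_subset_convexHull hT.1 hT'.1 ⟨hzT, hzT'⟩)
  rw [hline, hline, hself, hself] at this
  have := mul_left_cancel₀ ht0.ne' (add_left_cancel this)
  linarith

end Mesh

/-! ### Lipschitz functions and gradients of affine functions. -/

section Analysis

variable {E : Type*} [NormedAddCommGroup E] [InnerProductSpace ℝ E]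

/-- A continuous function that is Lipschitz on each of finitely many closed sets covering the space
is Lipschitz. -/
theorem lipschitzWith_of_finite_closed_cover {ι : Type*} {I : Set ι} (hI : I.Finite)
    {K : ι → Set E} (hK : ∀ i ∈ I, IsClosed (K i)) (hcov : ∀ x, ∃ i ∈ I, x ∈ K i) {f : E → ℝ}
    (hf : Continuous f) {L : ℝ≥0} (hL : ∀ i ∈ I, LipschitzOnWith L f (K i)) :
    LipschitzWith L f := by
  have key : ∀ x y, f y - f x ≤ L * dist x y := by
    intro x y
    have hline : Continuous fun t : ℝ => (AffineMap.lineMap x y t : E) :=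
      AffineMap.lineMap_continuous
    have h := image_le_of_liminf_slope_right_le_deriv_boundary (a := 0) (b := 1)
      (f := fun t : ℝ => f (AffineMap.lineMap x y t) - f x)
      (B := fun t => L * dist x y * t) (B' := fun _ => L * dist x y)
      ((hf.comp hline).sub continuous_const).continuousOn (by simp)
      (continuous_const.mul continuous_id).continuousOn
      (fun t _ => by simpa using ((hasDerivAt_id t).const_mul (L * dist x y)).hasDerivWithinAt)
      ?_ (x := 1) (by simp)
    · simpa using h
    intro s _ r hr
    -- The mean value inequality needs only a frequent bound on right slopes, and by finiteness one
    -- closed set contains points of the segment arbitrarily close to `s` from the right.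
    obtain ⟨i, hi, hfreq⟩ : ∃ i ∈ I, ∃ᶠ z in 𝓝[>] s, (AffineMap.lineMap x y z : E) ∈ K i := by
      by_contra! h
      have h' : ∀ᶠ z in 𝓝[>] s, ∀ i ∈ I, (AffineMap.lineMap x y z : E) ∉ K i :=
        (eventually_all_finite hI).2 h
      obtain ⟨z, hz⟩ := h'.exists
      obtain ⟨i, hi, hzi⟩ := hcov (AffineMap.lineMap x y z)
      exact hz i hi hzi
    have hs : (AffineMap.lineMap x y s : E) ∈ K i :=
      (hK i hi).mem_of_frequently_of_tendsto hfreq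
        ((hline.tendsto s).mono_left nhdsWithin_le_nhds)
    refine (hfreq.and_eventually self_mem_nhdsWithin).mono fun z ⟨hz, hsz⟩ => ?_
    have hsz : s < z := hsz
    refine lt_of_le_of_lt ?_ hr
    have h1 := (hL i hi).dist_le_mul _ hz _ hs
    rw [dist_lineMap_lineMap, Real.dist_eq, Real.dist_eq, abs_of_pos (sub_pos.2 hsz)] at h1
    have h2 := (le_abs_self _).trans h1
    rw [slope_def_field, div_le_iff₀ (sub_pos.2 hsz)]
    linarith
  refine LipschitzWith.of_dist_le_mul fun x y => ?_
  rw [Real.dist_eq, abs_sub_le_iff]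
  refine ⟨?_, key x y⟩
  rw [dist_comm]
  exact key y x

variable [FiniteDimensional ℝ E]

/-- The gradient of an affine function. -/
def affineGrad (a : E →ᵃ[ℝ] ℝ) : E :=
  (InnerProductSpace.toDual ℝ E).symm (LinearMap.toContinuousLinearMap a.linear)

theorem inner_affineGrad (a : E →ᵃ[ℝ] ℝ) (y : E) : inner ℝ (affineGrad a) y = a.linear y := by
  rw [affineGrad, InnerProductSpace.toDual_symm_apply]
  rfl

theorem affine_apply_add (a : E →ᵃ[ℝ] ℝ) (x y : E) :
    a (x + y) = a x + inner ℝ (affineGrad a) y := by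
  rw [inner_affineGrad, add_comm x y, ← vadd_eq_add y x, a.map_vadd, vadd_eq_add, add_comm]

theorem affine_apply_eq (a : E →ᵃ[ℝ] ℝ) (x y : E) :
    a y = a x + inner ℝ (affineGrad a) (y - x) := by
  rw [← affine_apply_add, add_sub_cancel]

theorem hasFDerivAt_affine (a : E →ᵃ[ℝ] ℝ) (x : E) :
    HasFDerivAt a (LinearMap.toContinuousLinearMap a.linear) x := by
  have h : (a : E → ℝ) = fun y => LinearMap.toContinuousLinearMap a.linear y + a 0 := by
    ext y
    simpa using congrFun a.decomp y
  rw [h]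
  exact (ContinuousLinearMap.hasFDerivAt _).add_const _

theorem gradient_eq_affineGrad {a : E →ᵃ[ℝ] ℝ} {u : E → ℝ} {x : E} (h : u =ᶠ[𝓝 x] a) :
    gradient u x = affineGrad a := by
  rw [gradient, h.fderiv_eq, (hasFDerivAt_affine a x).fderiv, affineGrad]

theorem lipschitzWith_affine (a : E →ᵃ[ℝ] ℝ) : LipschitzWith ‖affineGrad a‖₊ a := by
  refine LipschitzWith.of_dist_le_mul fun x y => ?_
  rw [affine_apply_eq a y x, Real.dist_eq, add_sub_cancel_left, dist_eq_norm]
  exact abs_real_inner_le_norm _ _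

/-- Shifting the centre by `r/2` along the gradient, in the direction that increases `|b|`, gains
`r/2 * ‖∇b‖`; a ball of radius `r/4` gives back at most half of this. It supplies the lower `L²`
bound of the inverse estimate. -/
theorem exists_closedBall_le_abs_affine (b : E →ᵃ[ℝ] ℝ) (x : E) {r : ℝ} (hr : 0 < r) :
    ∃ z, Metric.closedBall z (r / 4) ⊆ Metric.closedBall x r ∧
      ∀ y ∈ Metric.closedBall z (r / 4), |b x| + r / 4 * ‖affineGrad b‖ ≤ |b y| := by
  set G := affineGrad b with hG
  obtain ⟨s, hs, hsb⟩ : ∃ s : ℝ, |s| = 1 ∧ s * b x = |b x| := by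
    rcases le_total 0 (b x) with h | h
    · exact ⟨1, by simp, by rw [abs_of_nonneg h, one_mul]⟩
    · exact ⟨-1, by simp, by rw [abs_of_nonpos h]; ring⟩
  have hss : s * s = 1 := by rw [← abs_mul_abs_self, hs, one_mul]
  set e := ‖G‖⁻¹ • G with he
  have he1 : ‖e‖ ≤ 1 := by
    rw [he, norm_smul, norm_inv, norm_norm]
    exact inv_mul_le_one
  have hGe : inner ℝ G e = ‖G‖ := by
    rw [he, real_inner_smul_right, real_inner_self_eq_norm_sq]
    by_cases h : ‖G‖ = 0
    · simp [h]
    · field_simp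
  have hz : ‖(s * (r / 2)) • e‖ ≤ r / 2 := by
    rw [norm_smul, Real.norm_eq_abs, abs_mul, hs, one_mul, abs_of_pos (by positivity)]
    nlinarith
  refine ⟨x + (s * (r / 2)) • e, ?_, fun y hy => ?_⟩
  · refine Metric.closedBall_subset_closedBall' ?_
    rw [dist_eq_norm, add_sub_cancel_left]
    linarith
  · set p := y - (x + (s * (r / 2)) • e) with hp
    have hpn : ‖p‖ ≤ r / 4 := by simpa [dist_eq_norm] using hy
    have hy' : b y = b x + s * (r / 2) * ‖G‖ + inner ℝ G p := by
      rw [show y = x + ((s * (r / 2)) • e + p) by rw [hp]; abel, affine_apply_add, ← hG,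
        inner_add_right, real_inner_smul_right, hGe, add_assoc]
    have h1 : |s * inner ℝ G p| ≤ ‖G‖ * (r / 4) := by
      rw [abs_mul, hs, one_mul]
      exact (abs_real_inner_le_norm _ _).trans (by gcongr)
    have h2 : s * b y = |b x| + r / 2 * ‖G‖ + s * inner ℝ G p := by
      rw [hy', ← hsb]
      linear_combination (r / 2 * ‖G‖) * hss
    have h3 : s * b y ≤ |b y| := (le_abs_self _).trans (by rw [abs_mul, hs, one_mul])
    have := neg_abs_le (s * inner ℝ G p)
    linarith

/-- The values at the two ends of the diameter along the gradient differ by `2 r ‖∇a‖`. -/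
theorem norm_affineGrad_mul_le (a : E →ᵃ[ℝ] ℝ) {x : E} {r P : ℝ} (hr : 0 < r) (hP : 0 ≤ P)
    (h : ∀ y ∈ Metric.closedBall x r, |a y| ≤ P) : r * ‖affineGrad a‖ ≤ P := by
  set G := affineGrad a with hG
  by_cases hG0 : G = 0
  · simpa [hG0] using hP
  have hn : 0 < ‖G‖ := norm_pos_iff.2 hG0
  have hv : ‖(r / ‖G‖) • G‖ = r := by
    rw [norm_smul, Real.norm_eq_abs, abs_of_pos (by positivity)]
    field_simp
  have h1 := h (x + (r / ‖G‖) • G) (by simp [hv])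
  have h2 := h (x + -((r / ‖G‖) • G)) (by simp [hv])
  rw [affine_apply_add, ← hG] at h1 h2
  rw [inner_neg_right, real_inner_smul_right, real_inner_self_eq_norm_sq] at h2
  rw [real_inner_smul_right, real_inner_self_eq_norm_sq] at h1
  have h3 : r / ‖G‖ * ‖G‖ ^ 2 = r * ‖G‖ := by field_simp
  rw [h3] at h1 h2
  have := (abs_le.1 h1).2
  have := (abs_le.1 h2).1
  linarith

theorem inner_gradient_eq (u : E → ℝ) (x e : E) : inner ℝ (gradient u x) e = fderiv ℝ u x e := by
  rw [gradient, InnerProductSpace.toDual_symm_apply]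

theorem norm_gradient_le_of_lipschitzWith {u : E → ℝ} {L : ℝ≥0} (hu : LipschitzWith L u) (x : E) :
    ‖gradient u x‖ ≤ L := by
  rw [gradient, LinearIsometryEquiv.norm_map]
  exact norm_fderiv_le_of_lipschitz ℝ hu

/-! ### The inverse estimate and weak gradients. -/

variable [MeasurableSpace E] [BorelSpace E]

/-- An inverse estimate: an affine function `a` that is dominated on `K` by the maximum of an affine
function `b` is bounded in `H¹(K)` by `b` in `L²(K)`. -/
theorem lintegral_affine_le {K : Set E} {x : E} {r ρ : ℝ} (hr : 0 < r) (hρ : 0 ≤ ρ)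
    (hball : Metric.closedBall x r ⊆ K) (hK : K ⊆ Metric.closedBall x (ρ * r))
    (hKm : MeasurableSet K) (a b : E →ᵃ[ℝ] ℝ)
    (hab : ∀ P, (∀ y ∈ K, |b y| ≤ P) → ∀ y ∈ K, |a y| ≤ P) :
    (∫⁻ y in K, ‖a y‖ₑ ^ 2) + ‖affineGrad a‖ₑ ^ 2 * volume K ≤
      ENNReal.ofReal ((4 * ρ) ^ Module.finrank ℝ E * (1 + 4 * ρ) ^ 2 * (1 + (r ^ 2)⁻¹)) *
        ∫⁻ y in K, ‖b y‖ₑ ^ 2 := by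
  obtain ⟨z, hz, hzb⟩ := exists_closedBall_le_abs_affine b x hr
  set m := |b x| + r / 4 * ‖affineGrad b‖ with hm
  have hm0 : 0 ≤ m := by positivity
  -- The same quantity `m` bounds `|b|` below on the small ball and, up to the factor `1 + 4ρ`,
  -- above on all of `K`.
  have hb : ∀ y ∈ K, |b y| ≤ (1 + 4 * ρ) * m := by
    intro y hy
    have h1 : ‖y - x‖ ≤ ρ * r := by simpa [dist_eq_norm] using hK hy
    rw [affine_apply_eq b x y]
    have h2 : |inner ℝ (affineGrad b) (y - x)| ≤ ‖affineGrad b‖ * (ρ * r) :=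
      (abs_real_inner_le_norm _ _).trans (by gcongr)
    have h3 := abs_add_le (b x) (inner ℝ (affineGrad b) (y - x))
    have h4 : 0 ≤ ρ * |b x| := by positivity
    have h5 : 0 ≤ r * ‖affineGrad b‖ := by positivity
    rw [hm]
    nlinarith
  have ha := hab _ hb
  have hgrad : r * ‖affineGrad a‖ ≤ (1 + 4 * ρ) * m :=
    norm_affineGrad_mul_le a hr (by positivity) fun y hy => ha y (hball hy)
  set P := (1 + 4 * ρ) * m with hP
  have hP0 : 0 ≤ P := by positivity
  have hvol : volume K ≤ ENNReal.ofReal ((4 * ρ) ^ Module.finrank ℝ E) *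
      volume (Metric.closedBall z (r / 4)) := by
    refine (measure_mono hK).trans ?_
    rw [Measure.addHaar_closedBall _ _ (by positivity), Measure.addHaar_closedBall _ _ (by positivity),
      ← mul_assoc, ← ENNReal.ofReal_mul (by positivity), ← mul_pow]
    rw [show 4 * ρ * (r / 4) = ρ * r by ring]
  have hlow : ENNReal.ofReal (m ^ 2) * volume (Metric.closedBall z (r / 4)) ≤
      ∫⁻ y in K, ‖b y‖ₑ ^ 2 := by
    rw [← setLIntegral_const]
    refine (setLIntegral_mono' Metric.isClosed_closedBall.measurableSet fun y hy => ?_).trans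
      (lintegral_mono_set (hz.trans hball))
    rw [Real.enorm_eq_ofReal_abs, ← ENNReal.ofReal_pow (abs_nonneg _)]
    exact ENNReal.ofReal_le_ofReal (pow_le_pow_left₀ hm0 (hzb y hy) 2)
  have h1 : (∫⁻ y in K, ‖a y‖ₑ ^ 2) ≤ ENNReal.ofReal (P ^ 2) * volume K := by
    rw [← setLIntegral_const]
    refine setLIntegral_mono' hKm fun y hy => ?_
    rw [Real.enorm_eq_ofReal_abs, ← ENNReal.ofReal_pow (abs_nonneg _)]
    exact ENNReal.ofReal_le_ofReal (pow_le_pow_left₀ (abs_nonneg _) (ha y hy) 2)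
  have h2 : ‖affineGrad a‖ₑ ^ 2 ≤ ENNReal.ofReal (P ^ 2 * (r ^ 2)⁻¹) := by
    rw [← ofReal_norm, ← ENNReal.ofReal_pow (norm_nonneg _)]
    refine ENNReal.ofReal_le_ofReal ?_
    rw [← div_eq_mul_inv, le_div_iff₀ (by positivity), ← mul_pow, mul_comm]
    exact pow_le_pow_left₀ (by positivity) hgrad 2
  calc _ ≤ ENNReal.ofReal (P ^ 2) * volume K + ENNReal.ofReal (P ^ 2 * (r ^ 2)⁻¹) * volume K := by
        gcongr
    _ = ENNReal.ofReal (P ^ 2 * (1 + (r ^ 2)⁻¹)) * volume K := by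
        rw [← add_mul, ← ENNReal.ofReal_add (by positivity) (by positivity)]
        ring_nf
    _ ≤ ENNReal.ofReal (P ^ 2 * (1 + (r ^ 2)⁻¹)) * (ENNReal.ofReal ((4 * ρ) ^ Module.finrank ℝ E) *
          volume (Metric.closedBall z (r / 4))) := by gcongr
    _ = ENNReal.ofReal ((4 * ρ) ^ Module.finrank ℝ E * (1 + 4 * ρ) ^ 2 * (1 + (r ^ 2)⁻¹)) *
          (ENNReal.ofReal (m ^ 2) * volume (Metric.closedBall z (r / 4))) := by
        rw [← mul_assoc, ← mul_assoc, ← ENNReal.ofReal_mul (by positivity),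
          ← ENNReal.ofReal_mul (by positivity), hP]
        ring_nf
    _ ≤ _ := by gcongr

/-- Where a function is affine, its weak gradient is at least as long as the classical one. -/
theorem IsWeakGradient.enorm_affineGrad_le {U W : Set E} {w : E → ℝ} {g : E → E}
    (hg : IsWeakGradient U w g) (hW : IsOpen W) (hWU : W ⊆ U) {b : E →ᵃ[ℝ] ℝ}
    (hb : EqOn w b W) : ∀ᵐ x, x ∈ W → ‖affineGrad b‖ₑ ≤ ‖g x‖ₑ := by
  set G := affineGrad b with hG
  have hbd : Differentiable ℝ b := fun x => (hasFDerivAt_affine b x).differentiableAt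
  -- Only the component of `g` along `G` is identified: `⟨g, G⟩ = ‖G‖²` almost everywhere on `W`,
  -- and Cauchy–Schwarz gives the rest.
  have hloc : LocallyIntegrableOn (fun x => inner ℝ (g x) G - ‖G‖ ^ 2) W := by
    refine LocallyIntegrableOn.sub (fun x hx => ?_) ((locallyIntegrable_const _).locallyIntegrableOn W)
    obtain ⟨s, hs, hi⟩ := hg.locallyIntegrableOn_grad.mono_set hWU x hx
    exact ⟨s, hs, hi.inner_const (𝕜 := ℝ) G⟩
  have h0 := hW.ae_eq_zero_of_integral_contDiff_smul_eq_zero hloc ?_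
  · filter_upwards [h0] with x hx hxW
    have h1 : inner ℝ (g x) G = ‖G‖ ^ 2 := sub_eq_zero.1 (hx hxW)
    have h2 := real_inner_le_norm (g x) G
    rw [h1] at h2
    rw [← ofReal_norm, ← ofReal_norm]
    refine ENNReal.ofReal_le_ofReal ?_
    by_contra! h
    have : 0 < ‖G‖ := (norm_nonneg _).trans_lt h
    nlinarith
  intro φ hφ hc hs
  have hd : Continuous fun x => fderiv ℝ φ x G :=
    (hφ.continuous_fderiv (by simp)).clm_apply continuous_const
  have hdc : HasCompactSupport fun x => fderiv ℝ φ x G := hc.fderiv_apply (𝕜 := ℝ) G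
  have hds : tsupport (fun x => fderiv ℝ φ x G) ⊆ W := (tsupport_fderiv_apply_subset ℝ G).trans hs
  have hφ0 : ∀ x ∉ U, φ x = 0 := fun x hx => image_eq_zero_of_notMem_tsupport fun h => hx (hWU (hs h))
  have hd0 : ∀ x ∉ U, fderiv ℝ φ x G = 0 := fun x hx =>
    image_eq_zero_of_notMem_tsupport (f := fun x => fderiv ℝ φ x G) fun h => hx (hWU (hds h))
  have hfd : ∀ x, fderiv ℝ b x G = ‖G‖ ^ 2 := by
    intro x
    rw [(hasFDerivAt_affine b x).fderiv, LinearMap.coe_toContinuousLinearMap', ← inner_affineGrad,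
      ← hG, real_inner_self_eq_norm_sq]
  have hparts : ∫ x, b x * fderiv ℝ φ x G = - ∫ x, fderiv ℝ b x G * φ x := by
    refine integral_mul_fderiv_eq_neg_fderiv_mul_of_integrable ?_ ?_ ?_
      (fun x _ => hbd x) (fun x _ => hφ.differentiable (by simp) x)
    · simp only [hfd]
      exact (hφ.continuous.integrable_of_hasCompactSupport hc).const_mul _
    · exact (hbd.continuous.mul hd).integrable_of_hasCompactSupport hdc.mul_left
    · exact (hbd.continuous.mul hφ.continuous).integrable_of_hasCompactSupport hc.mul_left
  have hweak := hg.integral_eq φ hφ hc (hs.trans hWU) G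
  rw [setIntegral_eq_integral_of_forall_compl_eq_zero (fun x hx => by rw [hd0 x hx, mul_zero]),
    setIntegral_eq_integral_of_forall_compl_eq_zero (fun x hx => by rw [hφ0 x hx, mul_zero])]
    at hweak
  have hwb : ∀ x, w x * fderiv ℝ φ x G = b x * fderiv ℝ φ x G := by
    intro x
    by_cases hx : x ∈ W
    · rw [hb hx]
    · have : fderiv ℝ φ x G = 0 :=
        image_eq_zero_of_notMem_tsupport (f := fun x => fderiv ℝ φ x G) fun h => hx (hds h)
      rw [this, mul_zero, mul_zero]
  simp only [hwb, hparts, hfd, neg_inj] at hweak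
  have hi1 : Integrable fun x => inner ℝ (g x) G * φ x := by
    have := integrable_mul_of_tsupport hg.locallyIntegrableOn_grad hφ.continuous hc (hs.trans hWU)
    have h2 := this.inner_const (𝕜 := ℝ) G
    simp only [real_inner_smul_left, mul_comm (φ _)] at h2
    refine (integrableOn_iff_integrable_of_support_subset ?_).1 h2
    intro x hx
    by_contra hxU
    exact hx (by simp [hφ0 x hxU])
  have hi2 : Integrable fun x => ‖G‖ ^ 2 * φ x :=
    (hφ.continuous.integrable_of_hasCompactSupport hc).const_mul _
  simp only [smul_eq_mul, mul_comm (φ _), sub_mul]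
  rw [integral_sub hi1 hi2, hweak, sub_self]

theorem measurable_gradient (u : E → ℝ) : Measurable (gradient u) :=
  (InnerProductSpace.toDual ℝ E).symm.continuous.measurable.comp (measurable_fderiv ℝ u)

/-- The gradient of a Lipschitz function is a weak gradient. -/
theorem isWeakGradient_of_lipschitzWith {U : Set E} {u : E → ℝ} {L : ℝ≥0} (hu : LipschitzWith L u) :
    IsWeakGradient U u (gradient u) where
  locallyIntegrableOn_fun := hu.continuous.locallyIntegrable.locallyIntegrableOn U
  locallyIntegrableOn_grad := by
    have : MemLp (gradient u) ⊤ volume :=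
      memLp_top_of_bound (measurable_gradient u).aestronglyMeasurable L
        (.of_forall (norm_gradient_le_of_lipschitzWith hu))
    exact (this.locallyIntegrable le_top).locallyIntegrableOn U
  integral_eq φ hφ hc hs e := by
    have hφ0 : ∀ x ∉ U, φ x = 0 := fun x hx => image_eq_zero_of_notMem_tsupport fun h => hx (hs h)
    have hd0 : ∀ x ∉ U, fderiv ℝ φ x e = 0 := fun x hx =>
      image_eq_zero_of_notMem_tsupport (f := fun x => fderiv ℝ φ x e)
        fun h => hx (hs (tsupport_fderiv_apply_subset ℝ e h))
    rw [setIntegral_eq_integral_of_forall_compl_eq_zero (fun x hx => by rw [hd0 x hx, mul_zero]),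
      setIntegral_eq_integral_of_forall_compl_eq_zero (fun x hx => by rw [hφ0 x hx, mul_zero])]
    obtain ⟨D, hD⟩ := (hφ.of_le (m := 1) (by simp)).lipschitzWith_of_hasCompactSupport hc (by simp)
    have h := hu.integral_lineDeriv_mul_eq (μ := volume) hD hc e
    -- Rademacher's theorem turns directional derivatives into the gradient almost everywhere.
    have hl : ∀ᵐ x, lineDeriv ℝ u x e * φ x = inner ℝ (gradient u x) e * φ x := by
      filter_upwards [hu.ae_differentiableAt] with x hx
      rw [hx.lineDeriv_eq_fderiv, inner_gradient_eq]
    rw [integral_congr_ae hl] at h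
    rw [h, ← integral_neg]
    refine integral_congr_ae (.of_forall fun x => ?_)
    simp only
    rw [(hφ.differentiable (by simp) x).lineDeriv_eq_fderiv, map_neg]
    ring

theorem memH1_of_lipschitzWith {U : Set E} {u : E → ℝ} {L : ℝ≥0} (hu : LipschitzWith L u)
    (hc : HasCompactSupport u) (hU : volume U ≠ ⊤) : MemH1 U u := by
  have : IsFiniteMeasure (volume.restrict U) := ⟨by simpa using hU.lt_top⟩
  refine ⟨(hu.continuous.memLp_of_hasCompactSupport hc).restrict U, gradient u,
    isWeakGradient_of_lipschitzWith hu, ?_⟩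
  exact MemLp.of_bound (measurable_gradient u).aestronglyMeasurable L
    (.of_forall (norm_gradient_le_of_lipschitzWith hu))

end Analysis

/-! ### The finite element space and nodal interpolation. -/

namespace Mesh

variable {d : ℕ} (M : Mesh d)

theorem eq_zero_of_notMem_domain {u : EuclideanSpace ℝ (Fin d) → ℝ} (hu : u ∈ M.V)
    {x : EuclideanSpace ℝ (Fin d)} (hx : x ∉ M.domain) : u x = 0 := by
  by_cases h : x ∈ region M.cells
  · exact hu.2.2.1 x ⟨h, M.mem_frontier_domain_iff.2 ⟨h, hx⟩⟩
  · exact hu.2.2.2.2 x h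

/-- A piecewise affine function that vanishes outside the domain is Lipschitz. -/
theorem exists_lipschitzWith {u : EuclideanSpace ℝ (Fin d) → ℝ}
    (ha : ∀ T ∈ M.cells, ∃ a : EuclideanSpace ℝ (Fin d) →ᵃ[ℝ] ℝ,
      EqOn u a (convexHull ℝ (T : Set (EuclideanSpace ℝ (Fin d)))))
    (h0 : ∀ x ∉ M.domain, u x = 0) : ∃ L : ℝ≥0, LipschitzWith L u := by
  have := M.finite_cells.to_subtype
  have := Fintype.ofFinite M.cells
  -- The index `none` stands for the complement of the domain, so that the finite closed cover is of
  -- the whole space.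
  let K : Option M.cells → Set (EuclideanSpace ℝ (Fin d)) := fun i =>
    i.elim M.domainᶜ fun T => convexHull ℝ (T : Set (EuclideanSpace ℝ (Fin d)))
  have hK : ∀ i, IsClosed (K i) := by
    rintro (_ | T)
    · exact isOpen_interior.isClosed_compl
    · exact (isCompact_cell T.1).isClosed
  have hcov : ∀ x, ∃ i, x ∈ K i := by
    intro x
    by_cases hx : x ∈ M.domain
    · obtain ⟨T, hT, hxT⟩ := mem_region.1 (interior_subset hx)
      exact ⟨some ⟨T, hT⟩, hxT⟩
    · exact ⟨none, hx⟩
  have hL : ∀ i, ∃ L : ℝ≥0, LipschitzOnWith L u (K i) := by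
    rintro (_ | T)
    · refine ⟨0, fun x hx y hy => ?_⟩
      rw [h0 x hx, h0 y hy]
      simp
    · obtain ⟨a, ha⟩ := ha T.1 T.2
      refine ⟨‖affineGrad a‖₊, fun x hx y hy => ?_⟩
      rw [ha hx, ha hy]
      exact lipschitzWith_affine a x y
  choose L hL using hL
  have hc : Continuous u := (locallyFinite_of_finite K).continuous
    (iUnion_eq_univ_iff.2 hcov) hK fun i => (hL i).continuousOn
  refine ⟨Finset.univ.sup L, lipschitzWith_of_finite_closed_cover finite_univ (fun i _ => hK i)
    (fun x => ?_) hc fun i _ => (hL i).weaken (Finset.le_sup (Finset.mem_univ i))⟩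
  obtain ⟨i, hi⟩ := hcov x
  exact ⟨i, mem_univ i, hi⟩

theorem mem_V {u : EuclideanSpace ℝ (Fin d) → ℝ}
    (ha : ∀ T ∈ M.cells, ∃ a : EuclideanSpace ℝ (Fin d) →ᵃ[ℝ] ℝ,
      EqOn u a (convexHull ℝ (T : Set (EuclideanSpace ℝ (Fin d)))))
    (h0 : ∀ x ∉ M.domain, u x = 0) : u ∈ M.V := by
  obtain ⟨L, hL⟩ := M.exists_lipschitzWith ha h0
  have hR := M.isCompact_region Subset.rfl
  have hout : ∀ x ∉ region M.cells, u x = 0 := fun x hx => h0 x fun h => hx (interior_subset h)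
  refine ⟨memH1_of_lipschitzWith hL (HasCompactSupport.intro hR hout) ?_, hL.continuous.continuousOn,
    fun x hx => h0 x (M.mem_frontier_domain_iff.1 hx.2).2, ha, hout⟩
  exact ((measure_mono interior_subset).trans_lt hR.measure_lt_top).ne

theorem eq_of_eqOn_vertices {u u' : EuclideanSpace ℝ (Fin d) → ℝ} (hu : u ∈ M.V) (hu' : u' ∈ M.V)
    (h : EqOn u u' M.vertices) : u = u' := by
  ext x
  by_cases hx : x ∈ region M.cells
  · obtain ⟨T, hT, hxT⟩ := mem_region.1 hx
    obtain ⟨a, ha⟩ := hu.2.2.2.1 T hT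
    obtain ⟨a', ha'⟩ := hu'.2.2.2.1 T hT
    rw [ha hxT, ha' hxT]
    refine eqOn_convexHull_of_eqOn (fun v hv => ?_) hxT
    rw [← ha (subset_convexHull ℝ _ hv), ← ha' (subset_convexHull ℝ _ hv)]
    exact h (M.mem_vertices_of_mem hT hv)
  · rw [hu.2.2.2.2 x hx, hu'.2.2.2.2 x hx]

open Classical in
/-- The continuous piecewise affine function with given values at the nodes. -/
def nodalInterp (z : EuclideanSpace ℝ (Fin d) → ℝ) (x : EuclideanSpace ℝ (Fin d)) : ℝ :=
  if h : ∃ T ∈ M.cells, x ∈ convexHull ℝ (T : Set (EuclideanSpace ℝ (Fin d))) then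
    interp h.choose_spec.1 z x else 0

variable {M} {T : Finset (EuclideanSpace ℝ (Fin d))}

theorem nodalInterp_eq (hT : T ∈ M.cells) (z : EuclideanSpace ℝ (Fin d) → ℝ)
    {x : EuclideanSpace ℝ (Fin d)} (hx : x ∈ convexHull ℝ (T : Set (EuclideanSpace ℝ (Fin d)))) :
    M.nodalInterp z x = interp hT z x := by
  have h : ∃ T ∈ M.cells, x ∈ convexHull ℝ (T : Set (EuclideanSpace ℝ (Fin d))) := ⟨T, hT, hx⟩
  rw [nodalInterp, dif_pos h]
  exact interp_eq_interp _ hT z h.choose_spec.2 hx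

variable (M)

theorem nodalInterp_of_notMem (z : EuclideanSpace ℝ (Fin d) → ℝ) {x : EuclideanSpace ℝ (Fin d)}
    (hx : x ∉ region M.cells) : M.nodalInterp z x = 0 := by
  rw [mem_region] at hx
  rw [nodalInterp, dif_neg hx]

theorem nodalInterp_vertex (z : EuclideanSpace ℝ (Fin d) → ℝ) {v : EuclideanSpace ℝ (Fin d)}
    (hv : v ∈ M.vertices) : M.nodalInterp z v = z v := by
  obtain ⟨T, hT, hvT, hcard⟩ := M.exists_cell {v} hv
  have hvT := Finset.singleton_subset_iff.1 hvT
  have hT : T ∈ M.cells := ⟨hT, hcard⟩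
  rw [nodalInterp_eq hT z (subset_convexHull ℝ _ hvT), interp_apply hT z hvT]

/-- At a point of an element outside the open domain, vertices inside the domain have zero
barycentric weight and the others have zero nodal value. -/
theorem nodalInterp_mem {z : EuclideanSpace ℝ (Fin d) → ℝ}
    (hz : ∀ v ∈ M.vertices, v ∉ M.domain → z v = 0) : M.nodalInterp z ∈ M.V := by
  refine M.mem_V (fun T hT => ⟨interp hT z, fun x hx => nodalInterp_eq hT z hx⟩) fun x hxd => ?_
  by_cases hx : x ∈ region M.cells
  · obtain ⟨T, hT, hxT⟩ := mem_region.1 hx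
    rw [nodalInterp_eq hT z hxT, interp_eq_sum]
    refine Finset.sum_eq_zero fun v _ => ?_
    by_cases hv : (v : EuclideanSpace ℝ (Fin d)) ∈ M.domain
    · have h1 : 0 ≤ (basis hT).coord v x := by
        have := hxT
        rw [convexHull_eq hT] at this
        exact this v
      have h2 : ¬ 0 < (basis hT).coord v x := fun h =>
        hxd (mem_domain_of_coord_pos hT v.2 hv hxT h)
      rw [le_antisymm (not_lt.1 h2) h1, mul_zero]
    · rw [hz v (M.mem_vertices_of_mem hT v.2) hv, zero_mul]
  · exact M.nodalInterp_of_notMem z hx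

theorem diam_le_meshSize {T : Finset (EuclideanSpace ℝ (Fin d))} (hT : T ∈ M.cells) :
    Metric.diam (convexHull ℝ (T : Set (EuclideanSpace ℝ (Fin d)))) ≤ M.meshSize :=
  le_csSup (M.finite_cells.image _).bddAbove (mem_image_of_mem _ hT)

theorem diam_pos (hd : 0 < d) {T : Finset (EuclideanSpace ℝ (Fin d))} (hT : T ∈ M.cells) :
    0 < Metric.diam (convexHull ℝ (T : Set (EuclideanSpace ℝ (Fin d)))) := by
  obtain ⟨v, hv, v', hv', hne⟩ := Finset.one_lt_card.1 (show 1 < T.card by rw [hT.2]; omega)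
  exact (dist_pos.2 hne).trans_le (Metric.dist_le_diam_of_mem (isCompact_cell T).isBounded
    (subset_convexHull ℝ _ hv) (subset_convexHull ℝ _ hv'))

end Mesh

/-! ### The stitching operator and its norm. -/

namespace Decomposition

open Mesh

variable {d : ℕ} {M : Mesh d} {n : ℕ} {c : ℝ} (D : Decomposition M n c)

theorem cells_subset (i : Fin n) : D.cells i ⊆ M.cells := by
  rw [← D.iUnion_cells]
  exact subset_iUnion D.cells i

theorem interior_subdomain_subset (i : Fin n) : interior (D.subdomain i) ⊆ M.domain :=
  interior_mono (biUnion_subset_biUnion_left (D.cells_subset i))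

open Classical in
/-- The nodal values of the stitched function. -/
def stitchValue (i : Fin n) (w : EuclideanSpace ℝ (Fin d) → ℝ) (x : EuclideanSpace ℝ (Fin d)) : ℝ :=
  if x ∈ D.subdomain i \ frontier (D.subdomain i) then w x else 0

theorem stitchValue_of_mem (i : Fin n) (w : EuclideanSpace ℝ (Fin d) → ℝ)
    {x : EuclideanSpace ℝ (Fin d)} (hx : x ∈ interior (D.subdomain i)) :
    D.stitchValue i w x = w x := by
  rw [stitchValue, if_pos (by rwa [self_sdiff_frontier])]

theorem stitchValue_of_notMem (i : Fin n) (w : EuclideanSpace ℝ (Fin d) → ℝ)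
    {x : EuclideanSpace ℝ (Fin d)} (hx : x ∉ interior (D.subdomain i)) :
    D.stitchValue i w x = 0 := by
  rw [stitchValue, if_neg (by rwa [self_sdiff_frontier])]

theorem nodalInterp_stitchValue_mem (i : Fin n) (w : EuclideanSpace ℝ (Fin d) → ℝ) :
    M.nodalInterp (D.stitchValue i w) ∈ M.V :=
  M.nodalInterp_mem fun _ _ hv =>
    D.stitchValue_of_notMem i w fun h => hv (D.interior_subdomain_subset i h)

/-- The stitching operator. -/
def stitch (i : Fin n) : D.V i →ₗ[ℝ] M.V where
  toFun w := ⟨M.nodalInterp (D.stitchValue i w), D.nodalInterp_stitchValue_mem i w⟩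
  map_add' w w' := by
    refine Subtype.ext (M.eq_of_eqOn_vertices (D.nodalInterp_stitchValue_mem i _)
      (M.V.add_mem (D.nodalInterp_stitchValue_mem i _) (D.nodalInterp_stitchValue_mem i _))
      fun v hv => ?_)
    change _ = M.nodalInterp _ v + M.nodalInterp _ v
    simp only [M.nodalInterp_vertex _ hv, stitchValue]
    split_ifs <;> simp
  map_smul' t w := by
    refine Subtype.ext (M.eq_of_eqOn_vertices (D.nodalInterp_stitchValue_mem i _)
      (M.V.smul_mem t (D.nodalInterp_stitchValue_mem i _)) fun v hv => ?_)
    change _ = t * M.nodalInterp _ v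
    simp only [M.nodalInterp_vertex _ hv, stitchValue]
    split_ifs <;> simp

theorem existsUnique_isStitching (i : Fin n) : ∃! S : D.V i →ₗ[ℝ] M.V, D.IsStitching i S := by
  refine ⟨D.stitch i, fun w x hx => M.nodalInterp_vertex _ hx, fun S hS => ?_⟩
  refine LinearMap.ext fun w => Subtype.ext ?_
  refine M.eq_of_eqOn_vertices (S w).2 (D.stitch i w).2 fun v hv => ?_
  rw [hS w v hv]
  exact (M.nodalInterp_vertex (D.stitchValue i w) hv).symm

theorem IsStitching.apply_eq_stitchValue {D : Decomposition M n c} {i : Fin n}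
    {S : D.V i →ₗ[ℝ] M.V} (hS : D.IsStitching i S) (w : D.V i) {T : Finset (EuclideanSpace ℝ (Fin d))}
    (hT : T ∈ M.cells) {v : EuclideanSpace ℝ (Fin d)} (hv : v ∈ T) :
    (S w : EuclideanSpace ℝ (Fin d) → ℝ) v = D.stitchValue i w v :=
  hS w v (M.mem_vertices_of_mem hT hv)

variable {D} {i : Fin n} {S : D.V i →ₗ[ℝ] M.V}

/-- The stitched function vanishes on the elements outside the subdomain. -/
theorem IsStitching.eqOn_zero (hS : D.IsStitching i S) (w : D.V i)
    {T : Finset (EuclideanSpace ℝ (Fin d))} (hT : T ∈ M.cells) (hTi : T ∉ D.cells i) :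
    EqOn (S w : EuclideanSpace ℝ (Fin d) → ℝ) (0 : EuclideanSpace ℝ (Fin d) →ᵃ[ℝ] ℝ)
      (convexHull ℝ (T : Set (EuclideanSpace ℝ (Fin d)))) := by
  obtain ⟨a, ha⟩ := (S w).2.2.2.2.1 T hT
  refine ha.trans (eqOn_convexHull_of_eqOn fun v hv => ?_)
  rw [← ha (subset_convexHull ℝ _ hv), hS.apply_eq_stitchValue w hT hv,
    D.stitchValue_of_notMem i w fun h => hTi (mem_of_vertex_mem_interior (D.cells_subset i) hT hv h)]
  rfl

/-- The energy bound for the stitched function on an element of the subdomain. -/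
theorem IsStitching.lintegral_cell_le (hd : 0 < d) {σ : ℝ} (hσ : 0 < σ) (hc : 0 < c)
    (hM : M.IsShapeRegular σ) (hS : D.IsStitching i S) (w : D.V i)
    {T : Finset (EuclideanSpace ℝ (Fin d))} (hT : T ∈ D.cells i)
    {g : EuclideanSpace ℝ (Fin d) → EuclideanSpace ℝ (Fin d)}
    (hg : IsWeakGradient (interior (D.subdomain i)) (w : EuclideanSpace ℝ (Fin d) → ℝ) g) {κ : ℝ}
    (hκ : κ = (4 * (2 * σ)) ^ d * (1 + 4 * (2 * σ)) ^ 2) :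
    (∫⁻ x in interior (convexHull ℝ (T : Set (EuclideanSpace ℝ (Fin d)))),
      (‖(S w : EuclideanSpace ℝ (Fin d) → ℝ) x‖ₑ ^ 2 +
        ‖gradient (S w : EuclideanSpace ℝ (Fin d) → ℝ) x‖ₑ ^ 2)) ≤
    ENNReal.ofReal (((1 + κ + κ * (2 * σ / c) ^ 2) * (1 + M.meshSize⁻¹)) ^ 2) *
      ∫⁻ x in interior (convexHull ℝ (T : Set (EuclideanSpace ℝ (Fin d)))),
        (‖(w : EuclideanSpace ℝ (Fin d) → ℝ) x‖ₑ ^ 2 + ‖g x‖ₑ ^ 2) := by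
  set K := convexHull ℝ (T : Set (EuclideanSpace ℝ (Fin d))) with hKdef
  have hTM := D.cells_subset i hT
  have hh : 0 < M.meshSize := (M.diam_pos hd hTM).trans_le (M.diam_le_meshSize hTM)
  have hκ0 : 0 ≤ κ := by rw [hκ]; positivity
  set C := 1 + κ + κ * (2 * σ / c) ^ 2 with hC
  have hC1 : 1 ≤ C := by
    have : 0 ≤ κ * (2 * σ / c) ^ 2 := by positivity
    linarith
  have hhi : 0 < M.meshSize⁻¹ := inv_pos.2 hh
  -- The summand `1` in `C` ensures `C ≤ C ^ 2`, so that one constant serves after taking the square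
  -- root.
  have hCC : C * (1 + M.meshSize⁻¹ ^ 2) ≤ (C * (1 + M.meshSize⁻¹)) ^ 2 := by
    have h1 : C ≤ C ^ 2 := by nlinarith
    have h2 : 1 + M.meshSize⁻¹ ^ 2 ≤ (1 + M.meshSize⁻¹) ^ 2 := by nlinarith
    rw [mul_pow]
    exact mul_le_mul h1 h2 (by positivity) (by positivity)
  obtain ⟨a, ha⟩ := (S w).2.2.2.2.1 T hTM
  obtain ⟨b, hb⟩ := w.2.2.2.2.1 T hT
  have hu : ∀ x ∈ interior K, ‖(S w : EuclideanSpace ℝ (Fin d) → ℝ) x‖ₑ ^ 2 +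
      ‖gradient (S w : EuclideanSpace ℝ (Fin d) → ℝ) x‖ₑ ^ 2 = ‖a x‖ₑ ^ 2 + ‖affineGrad a‖ₑ ^ 2 := by
    intro x hx
    rw [ha (interior_subset hx), gradient_eq_affineGrad (a := a)
      (eventually_of_mem (isOpen_interior.mem_nhds hx) fun y hy => ha (interior_subset hy))]
  rw [setLIntegral_congr_fun isOpen_interior.measurableSet hu]
  have hav : ∀ v ∈ T, a v = D.stitchValue i w v := fun v hv => by
    rw [← ha (subset_convexHull ℝ _ hv), hS.apply_eq_stitchValue w hTM hv]
  have hbv : ∀ v ∈ T, b v = (w : EuclideanSpace ℝ (Fin d) → ℝ) v := fun v hv =>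
    (hb (subset_convexHull ℝ _ hv)).symm
  by_cases hvert : ∃ x ∈ T, x ∈ frontier (region (D.cells i)) \ frontier M.domain
  · have hdiam := D.le_diam i T hT hvert
    obtain ⟨x, r, hr, hball, hdr⟩ := hM T hTM
    have hKsub : K ⊆ Metric.closedBall x (2 * σ * r) := fun y hy => by
      rw [Metric.mem_closedBall]
      refine (Metric.dist_le_diam_of_mem (isCompact_cell T).isBounded hy
        (hball (Metric.mem_closedBall_self hr.le))).trans (hdr.trans (le_of_eq (by ring)))
    -- An affine function is bounded on a simplex by its vertex values, and those of `a` are values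
    -- of `b` or zero.
    have hab : ∀ P, (∀ y ∈ K, |b y| ≤ P) → ∀ y ∈ K, |a y| ≤ P := by
      intro P hP y hy
      refine abs_le_on_convexHull a (fun v hv => ?_) hy
      have hbP := hP v (subset_convexHull ℝ _ hv)
      rw [hav v hv]
      by_cases hvi : v ∈ interior (D.subdomain i)
      · rwa [D.stitchValue_of_mem i _ hvi, ← hbv v hv]
      · rw [D.stitchValue_of_notMem i _ hvi, abs_zero]
        exact (abs_nonneg _).trans hbP
    have hmain := lintegral_affine_le hr (by positivity : 0 ≤ 2 * σ) hball hKsub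
      (isCompact_cell T).measurableSet a b hab
    have hint : (interior K : Set (EuclideanSpace ℝ (Fin d))) =ᵐ[volume] K :=
      interior_ae_eq_of_null_frontier (volume_frontier_cell T)
    rw [← setLIntegral_congr hint, ← setLIntegral_congr hint, ← measure_congr hint,
      ← setLIntegral_const, finrank_euclideanSpace_fin, ← hκ,
      ← lintegral_add_right _ measurable_const] at hmain
    refine hmain.trans ?_
    refine mul_le_mul' (ENNReal.ofReal_le_ofReal (le_trans ?_ hCC)) ?_
    · have hri : r⁻¹ ≤ 2 * σ / c * M.meshSize⁻¹ := by
        rw [inv_eq_one_div, div_mul_eq_mul_div, div_le_div_iff₀ hr hc, one_mul, mul_right_comm,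
          ← div_eq_mul_inv, le_div_iff₀ hh]
        linarith
      have h2 : (r ^ 2)⁻¹ ≤ (2 * σ / c) ^ 2 * M.meshSize⁻¹ ^ 2 := by
        rw [← inv_pow, ← mul_pow]
        exact pow_le_pow_left₀ (by positivity) hri 2
      have h3 : κ * (r ^ 2)⁻¹ ≤ κ * ((2 * σ / c) ^ 2 * M.meshSize⁻¹ ^ 2) := by gcongr
      have h4 : 0 ≤ κ * (2 * σ / c) ^ 2 := by positivity
      have h5 : 0 ≤ κ * M.meshSize⁻¹ ^ 2 := by positivity
      rw [hC]
      nlinarith [sq_nonneg M.meshSize⁻¹]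
    · refine setLIntegral_mono' isOpen_interior.measurableSet fun y hy => ?_
      rw [hb (interior_subset hy)]
      exact le_self_add
  · push Not at hvert
    -- Without interface vertices, a vertex outside the interior of `ωᵢ` lies on `∂Ω`, where `w` is
    -- zero; stitching changes nothing on `T`.
    have hab : a = b := by
      have hEq : EqOn a b (T : Set (EuclideanSpace ℝ (Fin d))) := by
        intro v hv
        rw [hav v hv, hbv v hv]
        by_cases hvi : v ∈ interior (D.subdomain i)
        · rw [D.stitchValue_of_mem i _ hvi]
        · rw [D.stitchValue_of_notMem i _ hvi]
          have hvr : v ∈ region (D.cells i) := convexHull_subset_region hT (subset_convexHull ℝ _ hv)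
          have hvf : v ∈ frontier M.domain := by
            by_contra h
            exact hvert v hv ⟨⟨subset_closure hvr, hvi⟩, h⟩
          exact (w.2.2.2.1 v ⟨hvr, hvf⟩).symm
      ext x
      have := (basis hTM).tot
      rw [show range (basis hTM) = T by ext x; simp [basis_apply]] at this
      exact AffineMap.eqOn_affineSpan hEq (by rw [this]; trivial)
    subst hab
    have hone : 1 ≤ ENNReal.ofReal ((C * (1 + M.meshSize⁻¹)) ^ 2) := by
      rw [ENNReal.one_le_ofReal]
      refine le_trans ?_ hCC
      nlinarith [sq_nonneg M.meshSize⁻¹]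
    refine le_trans ?_ (le_mul_of_one_le_left' hone)
    have hgr := hg.enorm_affineGrad_le isOpen_interior
      (interior_mono (convexHull_subset_region hT)) (hb.mono interior_subset)
    refine lintegral_mono_ae ((ae_restrict_iff' isOpen_interior.measurableSet).2 ?_)
    filter_upwards [hgr] with x hx hxK
    rw [hb (interior_subset hxK)]
    gcongr
    exact hx hxK

/-- The norm bound for the stitching operator. -/
theorem IsStitching.opNorm_le (hd : 0 < d) {σ : ℝ} (hσ : 0 < σ) (hc : 0 < c)
    (hM : M.IsShapeRegular σ) (hS : D.IsStitching i S) {κ : ℝ}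
    (hκ : κ = (4 * (2 * σ)) ^ d * (1 + 4 * (2 * σ)) ^ 2) :
    D.opNorm i S ≤
      ENNReal.ofReal ((1 + κ + κ * (2 * σ / c) ^ 2) * (1 + M.meshSize⁻¹)) := by
  set Q := (1 + κ + κ * (2 * σ / c) ^ 2) * (1 + M.meshSize⁻¹) with hQ
  -- Only `0 ≤ h` is available: for the empty mesh `h = 0` and `h⁻¹ = 0`.
  have hh : 0 ≤ M.meshSize := Real.sSup_nonneg (by
    rintro _ ⟨T, -, rfl⟩
    exact Metric.diam_nonneg)
  have hκ0 : 0 ≤ κ := by rw [hκ]; positivity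
  have hQ0 : 0 < Q := by positivity
  refine iSup_le fun w => ENNReal.div_le_of_le_mul ?_
  -- The constant is moved to the left to isolate the infimum defining the norm of `w`; it then
  -- suffices to treat each weak gradient `g`.
  rw [mul_comm, ← ENNReal.div_le_iff (ENNReal.ofReal_pos.2 hQ0).ne' ENNReal.ofReal_ne_top]
  refine le_iInf₂ fun g hg => ?_
  rw [ENNReal.div_le_iff (ENNReal.ofReal_pos.2 hQ0).ne' ENNReal.ofReal_ne_top]
  set u := (S w : EuclideanSpace ℝ (Fin d) → ℝ)
  obtain ⟨L, hL⟩ := M.exists_lipschitzWith (S w).2.2.2.2.1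
    fun x hx => M.eq_zero_of_notMem_domain (S w).2 hx
  refine (iInf₂_le (gradient u) (isWeakGradient_of_lipschitzWith hL)).trans ?_
  set W := ⋃ T ∈ D.cells i, interior (convexHull ℝ (T : Set (EuclideanSpace ℝ (Fin d)))) with hW
  have hWm : MeasurableSet W := (isOpen_biUnion fun _ _ => isOpen_interior).measurableSet
  have hWi : W ⊆ interior (D.subdomain i) :=
    iUnion₂_subset fun T hT => interior_mono (convexHull_subset_region hT)
  have hcount : (D.cells i).Countable := (M.finite_cells.subset (D.cells_subset i)).countable
  have hdisj : (D.cells i).PairwiseDisjoint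
      fun T => interior (convexHull ℝ (T : Set (EuclideanSpace ℝ (Fin d)))) :=
    fun T hT T' hT' hne => disjoint_interior (D.cells_subset i hT) (D.cells_subset i hT') hne
  -- Off the null set of element boundaries, a point of the domain is interior to an element;
  -- outside `𝒯ᵢ` both `u` and its gradient vanish there.
  have hFW : ∫⁻ x in M.domain, (‖u x‖ₑ ^ 2 + ‖gradient u x‖ₑ ^ 2) ≤
      ∫⁻ x in W, (‖u x‖ₑ ^ 2 + ‖gradient u x‖ₑ ^ 2) := by
    rw [← lintegral_indicator (show MeasurableSet M.domain from isOpen_interior.measurableSet),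
      ← lintegral_indicator hWm]
    have hfr : ∀ᵐ x, ∀ T ∈ M.cells,
        x ∉ frontier (convexHull ℝ (T : Set (EuclideanSpace ℝ (Fin d)))) :=
      (ae_ball_iff M.finite_cells.countable).2 fun T _ =>
        measure_eq_zero_iff_ae_notMem.1 (volume_frontier_cell T)
    refine lintegral_mono_ae ?_
    filter_upwards [hfr] with x hx
    by_cases hxd : x ∈ M.domain
    swap
    · simp [indicator_of_notMem hxd]
    rw [indicator_of_mem hxd]
    obtain ⟨T, hT, hxT⟩ := mem_region.1 (interior_subset hxd)
    have hxi : x ∈ interior (convexHull ℝ (T : Set (EuclideanSpace ℝ (Fin d)))) := by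
      by_contra h
      exact hx T hT ⟨subset_closure hxT, h⟩
    by_cases hTi : T ∈ D.cells i
    · rw [indicator_of_mem (mem_biUnion hTi hxi)]
    · have h0 := hS.eqOn_zero w hT hTi
      have hgr : gradient u x = affineGrad 0 := gradient_eq_affineGrad
        (eventually_of_mem (isOpen_interior.mem_nhds hxi) fun y hy => h0 (interior_subset hy))
      have hz : affineGrad (0 : EuclideanSpace ℝ (Fin d) →ᵃ[ℝ] ℝ) = 0 := by simp [affineGrad]
      have hux : u x = 0 := h0 hxT
      simp [hux, hgr, hz]
  have hcells : ∫⁻ x in W, (‖u x‖ₑ ^ 2 + ‖gradient u x‖ₑ ^ 2) ≤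
      ENNReal.ofReal (Q ^ 2) *
        ∫⁻ x in W, (‖(w : EuclideanSpace ℝ (Fin d) → ℝ) x‖ₑ ^ 2 + ‖g x‖ₑ ^ 2) := by
    rw [hW, lintegral_biUnion hcount (fun _ _ => isOpen_interior.measurableSet) hdisj,
      lintegral_biUnion hcount (fun _ _ => isOpen_interior.measurableSet) hdisj,
      ← ENNReal.tsum_mul_left]
    exact ENNReal.tsum_le_tsum fun T => hS.lintegral_cell_le hd hσ hc hM w T.2 hg hκ
  have hwm : AEMeasurable (fun x => ‖(w : EuclideanSpace ℝ (Fin d) → ℝ) x‖ₑ ^ 2)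
      (volume.restrict (interior (D.subdomain i))) :=
    w.2.1.1.aestronglyMeasurable.enorm.pow_const 2
  have htotal := (hFW.trans hcells).trans
    (mul_le_mul' le_rfl (lintegral_mono_set hWi))
  rw [lintegral_add_left' hwm,
    lintegral_add_left (hL.continuous.measurable.enorm.pow_const 2)] at htotal
  refine (ENNReal.rpow_le_rpow htotal (by norm_num)).trans ?_
  rw [ENNReal.mul_rpow_of_nonneg _ _ (by norm_num), mul_comm]
  refine mul_le_mul' le_rfl (le_of_eq ?_)
  rw [ENNReal.ofReal_rpow_of_nonneg (by positivity) (by norm_num), ← Real.sqrt_eq_rpow,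
    Real.sqrt_sq hQ0.le]

end Decomposition

end FEM

end

theorem mainTheorem3 (d : ℕ) (hd : d = 2 ∨ d = 3) (σ c : ℝ) (hσ : 0 < σ) (hc : 0 < c) :
    ∃ C : ℝ, 0 < C ∧
      ∀ M : FEM.Mesh d, M.IsShapeRegular σ →
      ∀ (n : ℕ) (D : FEM.Decomposition M n c) (i : Fin n),
        (∃! S : D.V i →ₗ[ℝ] M.V, D.IsStitching i S) ∧
        ∀ S : D.V i →ₗ[ℝ] M.V, D.IsStitching i S →
          D.opNorm i S ≤ ENNReal.ofReal (C * (1 + M.meshSize⁻¹)) := by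
  have hd0 : 0 < d := by omega
  refine ⟨_, ?_, fun M hM n D i => ⟨D.existsUnique_isStitching i, fun S hS =>
    hS.opNorm_le hd0 hσ hc hM rfl⟩⟩
  positivity
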